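/- Let $d\ge 1$. A kernel on a set $X$ is a symmetric function $k:X\times X\to\mathbb{R}$ with $\sum_{l,j=1}^n\alpha_l\alpha_j k(x_l,x_j)\ge 0$ for all $n$, $\alpha_1,\dots,\alpha_n\in\mathbb{R}$ and $x_1,\dots,x_n\in X$; $\mathcal{H}$ denotes its reproducing kernel Hilbert space. A function $\psi$ on an abelian group is called positive definite if $(x,y)\mapsto\psi(x-y)$ is a kernel. A kernel $k$ is called - c-universal ($X$ compact Hausdorff, $k$ continuous) if $\mathcal{H}$ is dense in $C(X)$ for the uniform norm; - cc-universal ($X$ Hausdorff, $k$ continuous) if for every compact $Z\subset X$, every $g\in C(Z)$ and every $\epsilon>0$ there is $f\in\mathcal{H}$ with $\sup_{z\in Z}|f(z)-g(z)|\le\epsilon$; - $c_0$-universal ($X$ locally compact Hausdorff, $k$ bounded, $k(\cdot,x)\in C_0(X)$ for all $x$) if $\mathcal{H}$ is dense in $C_0(X)$ for the uniform norm; - characteristic ($k$ measurable and bounded) if the map $P\mapsto\int_X k(\cdot,x)\,dP(x)\in\mathcal{H}$ is injective on the set of all Borel probability measures on $X$. Then the following hold. (a) Let $0\ne\psi\in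 C_0(\mathbb{R}^d)$ be a positive definite function and $k(x,y)=\psi(x-y)$ on $\mathbb{R}^d$. Then $k$ is $c_0$-universal if and only if $k$ is characteristic. (b) Let $\psi\in C(\mathbb{T}^d)$ be a positive definite function on the torus $\mathbb{T}^d=(\mathbb{R}/2\pi\mathbb{Z})^d$, let $k(x,y)=\psi(x-y)$, and let $A_\psi(n)=(2\pi)^{-d}\int_{\mathbb{T}^d}e^{-i n^Tx}\psi(x)\,dx$, $n\in\mathbb{Z}^d$, be its (real) Fourier coefficients. If $k$ is characteristic and $A_\psi(0)>0$, then $k$ is c-universal. (c) Let $\nu$ be a finite nonnegative Borel measure on $[0,\infty)$ and $k(x,y)=\int_{[0,\infty)}e^{-t\|x-y\|_2^2}\,d\nu(t)$ for $x,y\in\mathbb{R}^d$. Then $k$ is cc-universal if and only if $k$ is characteristic. -/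

import Mathlib

open MeasureTheory
open scoped NNReal ZeroAtInfty

noncomputable section

/-! ### Kernels and their reproducing kernel Hilbert spaces -/

/-- A (real-valued, positive definite) kernel on `X`: a symmetric function `k : X × X → ℝ` with
`∑ l, ∑ j, α l * α j * k (x l) (x j) ≥ 0` for all finite families of points and coefficients. -/
structure IsPDKernel {X : Type*} (k : X → X → ℝ) : Prop where
  symm : ∀ x y, k x y = k y x
  nonneg : ∀ (n : ℕ) (α : Fin n → ℝ) (x : Fin n → X),
    0 ≤ ∑ l, ∑ j, α l * α j * k (x l) (x j)

/-- The scalar kernel `k`, viewed as a kernel with values in the operators on `ℝ`. -/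
def kernelMatrix {X : Type*} (k : X → X → ℝ) : Matrix X X (ℝ →L[ℝ] ℝ) :=
  Matrix.of fun x y => k x y • (1 : ℝ →L[ℝ] ℝ)

theorem IsPDKernel.posSemidef_kernelMatrix {X : Type*} {k : X → X → ℝ} (hk : IsPDKernel k) :
    (kernelMatrix k).PosSemidef := by
  have tfae := (RKHS.posSemidef_tfae (K := kernelMatrix k)).out 0 2
  refine tfae.mpr (And.intro ?_ fun v => ?_)
  · ext x y
    simp [kernelMatrix, Matrix.conjTranspose_apply, hk.symm x y]
  · have h := hk.nonneg v.support.card (fun l => v (v.support.equivFin.symm l))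
      (fun l => (v.support.equivFin.symm l : X))
    have e : ∀ F : X → ℝ, ∑ l, F (v.support.equivFin.symm l : X) = ∑ a ∈ v.support, F a := by
      intro F
      rw [Equiv.sum_comp v.support.equivFin.symm (fun a : v.support => F a)]
      exact Finset.sum_coe_sort v.support F
    rw [e (fun a => ∑ j, v a * v (v.support.equivFin.symm j) *
      k a (v.support.equivFin.symm j))] at h
    simp_rw [fun a => e (fun b => v a * v b * k a b)] at h
    refine h.trans (le_of_eq ?_)
    simp only [Finsupp.sum, RCLike.re_to_real]
    refine Finset.sum_congr rfl fun a _ => Finset.sum_congr rfl fun b _ => ?_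
    simp [kernelMatrix, hk.symm b a]
    ring

theorem IsPDKernel.fact_posSemidef {X : Type*} {k : X → X → ℝ} (hk : IsPDKernel k) :
    Fact (kernelMatrix k).PosSemidef :=
  ⟨hk.posSemidef_kernelMatrix⟩

/-- The reproducing kernel Hilbert space induced by the kernel `k`. -/
def IsPDKernel.Space {X : Type*} {k : X → X → ℝ} (hk : IsPDKernel k) : Type _ :=
  haveI := hk.fact_posSemidef
  RKHS.OfKernel (kernelMatrix k)

instance {X : Type*} {k : X → X → ℝ} (hk : IsPDKernel k) : NormedAddCommGroup hk.Space :=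
  haveI := hk.fact_posSemidef
  inferInstanceAs (NormedAddCommGroup (RKHS.OfKernel (kernelMatrix k)))

instance {X : Type*} {k : X → X → ℝ} (hk : IsPDKernel k) : InnerProductSpace ℝ hk.Space :=
  haveI := hk.fact_posSemidef
  inferInstanceAs (InnerProductSpace ℝ (RKHS.OfKernel (kernelMatrix k)))

instance {X : Type*} {k : X → X → ℝ} (hk : IsPDKernel k) : CompleteSpace hk.Space :=
  haveI := hk.fact_posSemidef
  inferInstanceAs (CompleteSpace (RKHS.OfKernel (kernelMatrix k)))

instance {X : Type*} {k : X → X → ℝ} (hk : IsPDKernel k) : RKHS ℝ hk.Space X ℝ :=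
  haveI := hk.fact_posSemidef
  inferInstanceAs (RKHS ℝ (RKHS.OfKernel (kernelMatrix k)) X ℝ)

/-- The element `k(·, x)` of the reproducing kernel Hilbert space induced by `k`. -/
def IsPDKernel.feature {X : Type*} {k : X → X → ℝ} (hk : IsPDKernel k) (x : X) : hk.Space :=
  RKHS.kerFun hk.Space x (1 : ℝ)

theorem IsPDKernel.feature_apply {X : Type*} {k : X → X → ℝ} (hk : IsPDKernel k) (x y : X) :
    hk.feature x y = k y x := by
  have := hk.fact_posSemidef
  have h : RKHS.kernel hk.Space = kernelMatrix k :=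
    RKHS.OfKernel.kernel_ofKernel (K := kernelMatrix k)
  rw [IsPDKernel.feature, RKHS.kerFun_apply, h]
  simp [kernelMatrix]

theorem IsPDKernel.inner_feature {X : Type*} {k : X → X → ℝ} (hk : IsPDKernel k)
    (f : hk.Space) (x : X) : inner ℝ f (hk.feature x) = f x := by
  simp [IsPDKernel.feature]

/-! ### Universal and characteristic kernels -/

/-- `k` is c-universal: it is a continuous kernel on the compact Hausdorff space `X`, and its
reproducing kernel Hilbert space is dense in `C(X)` for the uniform norm. -/
def IsCUniversal {X : Type*} [TopologicalSpace X] [CompactSpace X] [T2Space X]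
    (k : X → X → ℝ) : Prop :=
  Continuous (fun p : X × X => k p.1 p.2) ∧
  ∃ hk : IsPDKernel k, ∀ (g : C(X, ℝ)) (ε : ℝ), 0 < ε →
    ∃ f : hk.Space, ∀ x, |f x - g x| ≤ ε

/-- `k` is cc-universal: it is a continuous kernel on the Hausdorff space `X`, and for every
compact `Z ⊆ X` every `g ∈ C(Z)` is a uniform limit of restrictions to `Z` of elements of its
reproducing kernel Hilbert space. -/
def IsCCUniversal {X : Type*} [TopologicalSpace X] [T2Space X] (k : X → X → ℝ) : Prop :=
  Continuous (fun p : X × X => k p.1 p.2) ∧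
  ∃ hk : IsPDKernel k, ∀ (Z : Set X), IsCompact Z → ∀ (g : C(Z, ℝ)) (ε : ℝ), 0 < ε →
    ∃ f : hk.Space, ∀ z : Z, |f (z : X) - g z| ≤ ε

/-- `k` is c₀-universal: it is a bounded kernel on the locally compact Hausdorff space `X` with
`k(·, x) ∈ C₀(X)` for all `x`, and its reproducing kernel Hilbert space is dense in `C₀(X)` for
the uniform norm. -/
def IsC0Universal {X : Type*} [TopologicalSpace X] [LocallyCompactSpace X] [T2Space X]
    (k : X → X → ℝ) : Prop :=
  (∃ C : ℝ, ∀ x y, |k x y| ≤ C) ∧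
  (∀ x, ∃ h : C₀(X, ℝ), ∀ y, h y = k y x) ∧
  ∃ hk : IsPDKernel k, ∀ (g : C₀(X, ℝ)) (ε : ℝ), 0 < ε →
    ∃ f : hk.Space, ∀ x, |f x - g x| ≤ ε

/-- The mean embedding `P ↦ ∫ k(·, x) dP(x)` of Borel probability measures on `X` into the
reproducing kernel Hilbert space of `k` (a Bochner integral in that space). -/
def IsPDKernel.meanEmbedding {X : Type*} [MeasurableSpace X] {k : X → X → ℝ}
    (hk : IsPDKernel k) (P : ProbabilityMeasure X) : hk.Space :=
  ∫ x, hk.feature x ∂(P : Measure X)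

/-- `k` is characteristic (to the set of all Borel probability measures on `X`): it is a
measurable bounded kernel, and the mean embedding is injective. -/
def IsCharacteristic {X : Type*} [TopologicalSpace X] [MeasurableSpace X] [BorelSpace X]
    (k : X → X → ℝ) : Prop :=
  Measurable (fun p : X × X => k p.1 p.2) ∧
  (∃ C : ℝ, ∀ x y, |k x y| ≤ C) ∧
  ∃ hk : IsPDKernel k, Function.Injective hk.meanEmbedding

/-! ### The torus and radial kernels -/

instance factTwoPiPos : Fact (0 < 2 * Real.pi) := ⟨Real.two_pi_pos⟩

/-- The `d`-torus `(ℝ / 2πℤ)^d`. -/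
abbrev Torus (d : ℕ) : Type := Fin d → AddCircle (2 * Real.pi)

/-- The Fourier series coefficient `A_ψ(n) = (2π)^{-d} ∫ e^{-i n·x} ψ(x) dx`, `n ∈ ℤ^d`. -/
def torusFourierCoeff {d : ℕ} (ψ : C(Torus d, ℝ)) (n : Fin d → ℤ) : ℂ :=
  (((2 * Real.pi) ^ d : ℝ) : ℂ)⁻¹ *
    ∫ x : Torus d, (∏ i, fourier (-(n i)) (x i)) * (ψ x : ℂ)

/-- `k` is a radial (Schoenberg) kernel on `ℝ^d`: `k(x, y) = ∫ exp(-t ‖x - y‖²) dν(t)` for some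
finite Borel measure `ν` on `[0, ∞)`. -/
def IsSchoenbergKernel {d : ℕ}
    (k : EuclideanSpace ℝ (Fin d) → EuclideanSpace ℝ (Fin d) → ℝ) : Prop :=
  ∃ ν : Measure ℝ≥0, IsFiniteMeasure ν ∧
    ∀ x y, k x y = ∫ t : ℝ≥0, Real.exp (-(t : ℝ) * ‖x - y‖ ^ 2) ∂ν

end

open Filter Topology
open scoped CompactlySupported

/-! By Hahn–Banach and the Riesz representation of the dual of `C₀`, a subspace of `C₀(Z)` is dense
as soon as it separates pairs of finite regular measures
(`mem_topologicalClosure_of_separates_measures`). A characteristic kernel separates probability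
measures, hence by normalisation finite measures of equal mass
(`IsPDKernel.measure_eq_of_integral_eq`). To pass from characteristic to universal it remains to
remove the equal-mass condition.

(a) If μ₁ and μ₂ have equal potentials, so do μ₁ + τₐμ₂ and μ₂ + τₐμ₁, which also have equal mass
and therefore coincide. Thus μ₁ - μ₂ is a finite translation-invariant signed measure on a
nontrivial space, which must be zero. Conversely, density in `C₀` determines the integrals of test
functions.

(b) Integrating a potential against Haar measure gives the mass times ∫ψ, so a nonzero mean of ψ
forces equal masses.

(c) The kernel is the characteristic function of a scale mixture of Gaussians. If ν charges only 0,
the kernel is constant and neither property holds. Otherwise the mixture sees a nondegenerate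
Gaussian of full support, the kernel separates all finite measures, and both properties hold. -/

/-! ### The dual of `C₀(X, ℝ)` -/

section Riesz

variable {X : Type*} [TopologicalSpace X]

/-- A compactly supported nonnegative continuous function, as an element of `C₀(X, ℝ)`. -/
def CompactlySupportedContinuousMap.toZeroAtInfty (f : C_c(X, ℝ≥0)) : C₀(X, ℝ) where
  toFun x := f x
  continuous_toFun := by fun_prop
  zero_at_infty' := by
    have h : HasCompactSupport fun x => (f x : ℝ) :=
      f.hasCompactSupport.comp_left (g := fun r : ℝ≥0 => (r : ℝ)) rfl
    exact h.is_zero_at_infty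

open CompactlySupportedContinuousMap

@[simp]
theorem toZeroAtInfty_apply (f : C_c(X, ℝ≥0)) (x : X) : f.toZeroAtInfty x = f x := rfl

theorem toZeroAtInfty_add (f g : C_c(X, ℝ≥0)) :
    (f + g).toZeroAtInfty = f.toZeroAtInfty + g.toZeroAtInfty := by
  ext; simp

theorem toZeroAtInfty_smul (c : ℝ≥0) (f : C_c(X, ℝ≥0)) :
    (c • f).toZeroAtInfty = (c : ℝ) • f.toZeroAtInfty := by
  ext; simp

theorem ZeroAtInftyContinuousMap.norm_le_of_forall {f : C₀(X, ℝ)} {C : ℝ} (hC : 0 ≤ C)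
    (h : ∀ x, |f x| ≤ C) : ‖f‖ ≤ C := by
  rw [← ZeroAtInftyContinuousMap.norm_toBCF_eq_norm]
  exact (BoundedContinuousFunction.norm_le hC).2 h

theorem ZeroAtInftyContinuousMap.abs_apply_le (f : C₀(X, ℝ)) (x : X) : |f x| ≤ ‖f‖ := by
  rw [← ZeroAtInftyContinuousMap.norm_toBCF_eq_norm]
  exact f.toBCF.norm_coe_le_norm x

theorem norm_toZeroAtInfty_mono {f g : C_c(X, ℝ≥0)} (h : f ≤ g) :
    ‖f.toZeroAtInfty‖ ≤ ‖g.toZeroAtInfty‖ := by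
  refine ZeroAtInftyContinuousMap.norm_le_of_forall (norm_nonneg _) fun x => ?_
  refine le_trans ?_ (g.toZeroAtInfty.abs_apply_le x)
  simpa using h x

/-- The positive part of a bounded functional on `C₀(X, ℝ)`, on nonnegative compactly supported
functions. -/
noncomputable def upperPart (Λ : C₀(X, ℝ) →L[ℝ] ℝ) (f : C_c(X, ℝ≥0)) : ℝ :=
  ⨆ g : {g : C_c(X, ℝ≥0) // g ≤ f}, Λ (g : C_c(X, ℝ≥0)).toZeroAtInfty

variable (Λ : C₀(X, ℝ) →L[ℝ] ℝ)

theorem upperPart_apply_le_norm {f g : C_c(X, ℝ≥0)} (h : g ≤ f) :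
    Λ g.toZeroAtInfty ≤ ‖Λ‖ * ‖f.toZeroAtInfty‖ :=
  (le_abs_self _).trans <| (Λ.le_opNorm _).trans <|
    mul_le_mul_of_nonneg_left (norm_toZeroAtInfty_mono h) (norm_nonneg _)

instance (f : C_c(X, ℝ≥0)) : Nonempty {g : C_c(X, ℝ≥0) // g ≤ f} := ⟨⟨f, le_rfl⟩⟩

theorem le_upperPart {f g : C_c(X, ℝ≥0)} (h : g ≤ f) : Λ g.toZeroAtInfty ≤ upperPart Λ f :=
  le_ciSup (f := fun g : {g : C_c(X, ℝ≥0) // g ≤ f} => Λ (g : C_c(X, ℝ≥0)).toZeroAtInfty)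
    ⟨_, by rintro _ ⟨g, rfl⟩; exact upperPart_apply_le_norm Λ g.2⟩ ⟨g, h⟩

theorem upperPart_le {f : C_c(X, ℝ≥0)} {c : ℝ}
    (h : ∀ g : C_c(X, ℝ≥0), g ≤ f → Λ g.toZeroAtInfty ≤ c) : upperPart Λ f ≤ c :=
  ciSup_le fun g => h g g.2

theorem upperPart_nonneg (f : C_c(X, ℝ≥0)) : 0 ≤ upperPart Λ f := by
  have h := le_upperPart Λ (show (0 : C_c(X, ℝ≥0)) ≤ f from fun x => zero_le)
  rwa [show (0 : C_c(X, ℝ≥0)).toZeroAtInfty = 0 by ext; simp, map_zero] at h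

/-- Riesz decomposition: any u ≤ f + g splits as u ⊓ f plus a remainder below g. The other
inequality adds competitors for f and g. -/
theorem upperPart_add (f g : C_c(X, ℝ≥0)) :
    upperPart Λ (f + g) = upperPart Λ f + upperPart Λ g := by
  apply le_antisymm
  · refine upperPart_le Λ fun u hu => ?_
    obtain ⟨v, hv⟩ := CompactlySupportedContinuousMap.exists_add_of_le
      (inf_le_left : u ⊓ f ≤ u)
    have hvg : v ≤ g := fun x => by
      have h1 : u x ⊓ f x + v x = u x := congr($hv x)
      have h2 : u x ≤ f x + g x := hu x
      change v x ≤ g x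
      rcases le_total (u x) (f x) with h | h
      · rw [inf_eq_left.2 h] at h1
        have : v x = 0 := by simpa using h1
        simp [this]
      · rw [inf_eq_right.2 h] at h1
        rw [← h1] at h2
        exact le_of_add_le_add_left h2
    rw [← hv, toZeroAtInfty_add, map_add]
    exact add_le_add (le_upperPart Λ inf_le_right) (le_upperPart Λ hvg)
  · rw [← le_sub_iff_add_le]
    refine upperPart_le Λ fun u hu => ?_
    rw [le_sub_comm]
    refine upperPart_le Λ fun v hv => ?_
    have h := le_upperPart Λ (show u + v ≤ f + g from fun x => add_le_add (hu x) (hv x))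
    rw [toZeroAtInfty_add, map_add] at h
    linarith

theorem upperPart_smul_le (c : ℝ≥0) (f : C_c(X, ℝ≥0)) :
    c * upperPart Λ f ≤ upperPart Λ (c • f) := by
  rcases eq_or_ne c 0 with rfl | hc
  · simpa using upperPart_nonneg Λ _
  have hc' : (0 : ℝ) < c := by positivity
  rw [← le_div_iff₀' hc']
  refine upperPart_le Λ fun g hg => ?_
  rw [le_div_iff₀' hc']
  have h := le_upperPart Λ (show c • g ≤ c • f from fun x => by
    simpa using mul_le_mul_right (hg x) c)
  simpa [toZeroAtInfty_smul] using h

theorem upperPart_smul (c : ℝ≥0) (f : C_c(X, ℝ≥0)) :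
    upperPart Λ (c • f) = c * upperPart Λ f := by
  refine le_antisymm ?_ (upperPart_smul_le Λ c f)
  rcases eq_or_ne c 0 with rfl | hc
  · refine upperPart_le Λ fun g hg => ?_
    have : g.toZeroAtInfty = 0 := by
      ext x
      simpa using hg x
    simp [this]
  have hc' : (0 : ℝ) < c := by positivity
  -- The reverse inequality is the one already known, applied to the inverse scalar.
  have h := upperPart_smul_le Λ c⁻¹ (c • f)
  rw [smul_smul, inv_mul_cancel₀ hc, one_smul, NNReal.coe_inv, inv_mul_le_iff₀ hc'] at h
  exact h

/-- The positive part of a bounded functional on `C₀(X, ℝ)`, as a positive linear functional. -/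
noncomputable def posLinear : C_c(X, ℝ≥0) →ₗ[ℝ≥0] ℝ≥0 where
  toFun f := ⟨upperPart Λ f, upperPart_nonneg Λ f⟩
  map_add' f g := NNReal.eq (upperPart_add Λ f g)
  map_smul' c f := NNReal.eq (upperPart_smul Λ c f)

/-- The negative part of a bounded functional on `C₀(X, ℝ)`, as a positive linear functional. -/
noncomputable def negLinear : C_c(X, ℝ≥0) →ₗ[ℝ≥0] ℝ≥0 where
  toFun f := ⟨upperPart Λ f - Λ f.toZeroAtInfty, sub_nonneg.2 (le_upperPart Λ le_rfl)⟩
  map_add' f g := NNReal.eq (by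
    change upperPart Λ (f + g) - Λ (f + g).toZeroAtInfty =
      (upperPart Λ f - Λ f.toZeroAtInfty) + (upperPart Λ g - Λ g.toZeroAtInfty)
    rw [upperPart_add, toZeroAtInfty_add, map_add]
    ring)
  map_smul' c f := NNReal.eq (by
    change upperPart Λ (c • f) - Λ (c • f).toZeroAtInfty =
      c * (upperPart Λ f - Λ f.toZeroAtInfty)
    rw [upperPart_smul, toZeroAtInfty_smul, map_smul, smul_eq_mul]
    ring)

theorem toZeroAtInfty_norm_le_one {f : C_c(X, ℝ≥0)} (hf : ∀ x, f x ≤ 1) :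
    ‖f.toZeroAtInfty‖ ≤ 1 :=
  ZeroAtInftyContinuousMap.norm_le_of_forall zero_le_one fun x => by
    simpa using hf x

/-- Soft thresholding: (f - ε)⁺ has compact support, and (f - ε)⁺ - (-f - ε)⁺ is within ε of f. -/
theorem denseRange_toZeroAtInfty_sub :
    DenseRange fun p : C_c(X, ℝ≥0) × C_c(X, ℝ≥0) => p.1.toZeroAtInfty - p.2.toZeroAtInfty := by
  have key : ∀ (f : C₀(X, ℝ)) (ε : ℝ), 0 < ε →
      ∃ g : C_c(X, ℝ≥0), ∀ x, g x = (f x - ε).toNNReal := by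
    intro f ε hε
    refine ⟨⟨⟨fun x => (f x - ε).toNNReal, by fun_prop⟩, ?_⟩, fun x => rfl⟩
    have h := f.zero_at_infty'.eventually (gt_mem_nhds hε)
    obtain ⟨K, hK, hKf⟩ := mem_cocompact.1 h
    refine HasCompactSupport.intro' (K := {x | ε ≤ f x}) ?_ ?_ ?_
    · refine hK.of_isClosed_subset (isClosed_le continuous_const f.continuous) fun x hx => ?_
      by_contra hxK
      have h1 : f x < ε := hKf hxK
      exact absurd hx (not_le.2 h1)
    · exact isClosed_le continuous_const f.continuous
    · intro x hx
      have : f x < ε := not_le.1 hx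
      simpa using this.le
  rw [Metric.denseRange_iff]
  intro f r hr
  obtain ⟨g, hg⟩ := key f (r / 2) (by positivity)
  obtain ⟨h, hh⟩ := key (-f) (r / 2) (by positivity)
  refine ⟨(g, h), lt_of_le_of_lt ?_ (half_lt_self hr)⟩
  rw [dist_eq_norm]
  refine ZeroAtInftyContinuousMap.norm_le_of_forall (by positivity) fun x => ?_
  simp only [ZeroAtInftyContinuousMap.coe_sub, Pi.sub_apply, toZeroAtInfty_apply, hg, hh,
    Real.coe_toNNReal', ZeroAtInftyContinuousMap.coe_neg, Pi.neg_apply]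
  rw [abs_le]
  constructor <;>
  rcases max_cases (f x - r / 2) 0 with h | h <;> rcases max_cases (-f x - r / 2) 0 with h' | h' <;>
  linarith

variable [MeasurableSpace X] [BorelSpace X]

theorem ZeroAtInftyContinuousMap.integrable (μ : Measure X) [IsFiniteMeasure μ] (f : C₀(X, ℝ)) :
    Integrable f μ :=
  f.toBCF.integrable μ

theorem continuous_integral_zeroAtInfty (μ : Measure X) [IsFiniteMeasure μ] :
    Continuous fun f : C₀(X, ℝ) => ∫ x, f x ∂μ := by
  refine (LipschitzWith.of_dist_le_mul (K := (μ Set.univ).toNNReal) fun f g => ?_).continuous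
  rw [Real.dist_eq, ← integral_sub (f.integrable μ) (g.integrable μ), dist_eq_norm, mul_comm]
  exact norm_integral_le_of_norm_le_const (f := fun x => f x - g x)
    (.of_forall fun x => (f - g).abs_apply_le x)

variable [T2Space X] [LocallyCompactSpace X]

/-- By inner regularity only compact sets matter; a Urysohn function with values in [0, 1] dominates
the indicator of each, so C bounds the total mass. -/
theorem NNRealRMK.isFiniteMeasure_rieszMeasure (T : C_c(X, ℝ≥0) →ₗ[ℝ≥0] ℝ≥0) (C : ℝ≥0)
    (hC : ∀ f, (∀ x, f x ≤ 1) → T f ≤ C) : IsFiniteMeasure (NNRealRMK.rieszMeasure T) := by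
  refine ⟨lt_of_le_of_lt ?_ (ENNReal.coe_lt_top (r := C))⟩
  rw [isOpen_univ.measure_eq_iSup_isCompact]
  refine iSup₂_le fun K _ => iSup_le fun hK => ?_
  obtain ⟨f, h1, -, hc, h01⟩ := exists_continuous_one_zero_of_isCompact hK isClosed_empty
    (Set.disjoint_empty K)
  let F : C_c(X, ℝ≥0) :=
    ⟨⟨fun x => (f x).toNNReal, by fun_prop⟩,
      hc.comp_left (g := Real.toNNReal) Real.toNNReal_zero⟩
  have hF1 : ∀ x, F x ≤ 1 := fun x => by
    simpa [F] using (h01 x).2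
  refine le_trans ?_ (ENNReal.coe_le_coe.2 (hC F hF1))
  rw [← NNRealRMK.lintegral_rieszMeasure T F, ← lintegral_indicator_one hK.measurableSet]
  refine lintegral_mono fun x => ?_
  by_cases hx : x ∈ K
  · simp [hx, F, h1 hx]
  · simp [hx]

instance : IsFiniteMeasure (NNRealRMK.rieszMeasure (posLinear Λ)) := by
  refine NNRealRMK.isFiniteMeasure_rieszMeasure _ ‖Λ‖₊ fun f hf => ?_
  change upperPart Λ f ≤ ‖Λ‖
  refine upperPart_le Λ fun g hg => (upperPart_apply_le_norm Λ hg).trans ?_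
  exact mul_le_of_le_one_right (norm_nonneg Λ) (toZeroAtInfty_norm_le_one hf)

instance : IsFiniteMeasure (NNRealRMK.rieszMeasure (negLinear Λ)) := by
  refine NNRealRMK.isFiniteMeasure_rieszMeasure _ (‖Λ‖₊ + ‖Λ‖₊) fun f hf => ?_
  change upperPart Λ f - Λ f.toZeroAtInfty ≤ ‖Λ‖ + ‖Λ‖
  have h1 : ‖Λ‖ * ‖f.toZeroAtInfty‖ ≤ ‖Λ‖ :=
    mul_le_of_le_one_right (norm_nonneg Λ) (toZeroAtInfty_norm_le_one hf)
  have h2 : upperPart Λ f ≤ ‖Λ‖ :=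
    upperPart_le Λ fun g hg => (upperPart_apply_le_norm Λ hg).trans h1
  have h3 := neg_le_of_abs_le ((Λ.le_opNorm f.toZeroAtInfty).trans h1)
  linarith

theorem exists_measure_sub_eq :
    ∃ μ₁ μ₂ : Measure X, IsFiniteMeasure μ₁ ∧ IsFiniteMeasure μ₂ ∧ μ₁.Regular ∧ μ₂.Regular ∧
      ∀ f : C₀(X, ℝ), Λ f = ∫ x, f x ∂μ₁ - ∫ x, f x ∂μ₂ := by
  refine ⟨NNRealRMK.rieszMeasure (posLinear Λ), NNRealRMK.rieszMeasure (negLinear Λ),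
    inferInstance, inferInstance, inferInstance, inferInstance, fun f => ?_⟩
  have key : ∀ g : C_c(X, ℝ≥0), Λ g.toZeroAtInfty =
      ∫ x, g.toZeroAtInfty x ∂(NNRealRMK.rieszMeasure (posLinear Λ)) -
      ∫ x, g.toZeroAtInfty x ∂(NNRealRMK.rieszMeasure (negLinear Λ)) := fun g => by
    simp only [toZeroAtInfty_apply, NNRealRMK.integral_rieszMeasure]
    change _ = upperPart Λ g - (upperPart Λ g - Λ g.toZeroAtInfty)
    ring
  -- Both sides are continuous in f, so agreement on differences of nonnegative compactly supported
  -- functions is enough.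
  refine congrFun (denseRange_toZeroAtInfty_sub.equalizer Λ.continuous
    ((continuous_integral_zeroAtInfty _).sub (continuous_integral_zeroAtInfty _)) ?_) f
  funext p
  simp only [Function.comp_apply, map_sub, key, ZeroAtInftyContinuousMap.coe_sub, Pi.sub_apply]
  rw [integral_sub (ZeroAtInftyContinuousMap.integrable _ _)
    (ZeroAtInftyContinuousMap.integrable _ _), integral_sub
    (ZeroAtInftyContinuousMap.integrable _ _) (ZeroAtInftyContinuousMap.integrable _ _)]
  ring

/-- A subspace of `C₀(X, ℝ)` that separates finite regular measures is dense. -/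
theorem mem_topologicalClosure_of_separates_measures (S : Submodule ℝ C₀(X, ℝ))
    (h : ∀ μ₁ μ₂ : Measure X, IsFiniteMeasure μ₁ → IsFiniteMeasure μ₂ → μ₁.Regular → μ₂.Regular →
      (∀ f ∈ S, ∫ x, f x ∂μ₁ = ∫ x, f x ∂μ₂) → μ₁ = μ₂) (g : C₀(X, ℝ)) :
    g ∈ S.topologicalClosure := by
  by_contra hg
  obtain ⟨Λ, u, h1, h2⟩ := geometric_hahn_banach_closed_point
    (s := (S.topologicalClosure : Set C₀(X, ℝ))) S.topologicalClosure.convex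
    S.isClosed_topologicalClosure hg
  have h0 : ∀ f ∈ S.topologicalClosure, Λ f = 0 := by
    intro f hf
    by_contra hne
    -- A functional bounded above by u on a subspace vanishes there: otherwise a multiple of f takes
    -- the value u + 1.
    have := h1 (((u + 1) / Λ f) • f) (S.topologicalClosure.smul_mem _ hf)
    rw [map_smul, smul_eq_mul, div_mul_cancel₀ _ hne] at this
    linarith
  have hu : 0 < u := by simpa using h1 0 (S.topologicalClosure.zero_mem)
  obtain ⟨μ₁, μ₂, i1, i2, r1, r2, hΛ⟩ := exists_measure_sub_eq Λ
  have : μ₁ = μ₂ := h μ₁ μ₂ i1 i2 r1 r2 fun f hf => by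
    have := h0 f (S.le_topologicalClosure hf)
    rw [hΛ] at this
    linarith
  have hz : Λ g = 0 := by rw [hΛ, this, sub_self]
  linarith

end Riesz

/-! ### Mean embeddings -/

section MeanEmbedding

variable {X : Type*} {k : X → X → ℝ} (hk : IsPDKernel k)

theorem IsPDKernel.inner_feature_feature (x y : X) :
    inner ℝ (hk.feature x) (hk.feature y) = k x y := by
  rw [hk.inner_feature, hk.feature_apply, hk.symm]

theorem IsPDKernel.norm_feature_sq (x : X) : ‖hk.feature x‖ ^ 2 = k x x := by
  rw [← real_inner_self_eq_norm_sq, hk.inner_feature_feature]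

theorem IsPDKernel.continuous_feature [TopologicalSpace X]
    (hc : Continuous fun p : X × X => k p.1 p.2) : Continuous hk.feature := by
  rw [continuous_iff_continuousAt]
  intro x
  rw [ContinuousAt, tendsto_iff_norm_sub_tendsto_zero]
  have h : Continuous fun y => √(k y y - 2 * k y x + k x x) := by
    have h1 : Continuous fun y => k y y := hc.comp (continuous_id.prodMk continuous_id)
    have h2 : Continuous fun y => k y x := hc.comp (continuous_id.prodMk continuous_const)
    fun_prop
  have h0 := h.tendsto x
  have e : k x x - 2 * k x x + k x x = 0 := by ring
  rw [e, Real.sqrt_zero] at h0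
  refine h0.congr fun y => ?_
  rw [← hk.norm_feature_sq y, ← hk.norm_feature_sq x, ← hk.inner_feature_feature y x,
    ← norm_sub_sq_real, Real.sqrt_sq (norm_nonneg _)]

variable [TopologicalSpace X] [SecondCountableTopology X] [MeasurableSpace X] [BorelSpace X]

theorem IsPDKernel.integrable_feature (hc : Continuous fun p : X × X => k p.1 p.2) {C : ℝ}
    (hC : ∀ x y, |k x y| ≤ C) (μ : Measure X) [IsFiniteMeasure μ] :
    Integrable hk.feature μ := by
  refine Integrable.of_bound (hk.continuous_feature hc).aestronglyMeasurable (√C)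
    (.of_forall fun x => Real.le_sqrt_of_sq_le ?_)
  rw [hk.norm_feature_sq]
  exact (le_abs_self _).trans (hC x x)

theorem IsPDKernel.inner_integral_feature (hc : Continuous fun p : X × X => k p.1 p.2) {C : ℝ}
    (hC : ∀ x y, |k x y| ≤ C) (μ : Measure X) [IsFiniteMeasure μ] (f : hk.Space) :
    inner ℝ f (∫ x, hk.feature x ∂μ) = ∫ x, f x ∂μ := by
  rw [← integral_inner (𝕜 := ℝ) (hk.integrable_feature hc hC μ)]
  simp only [hk.inner_feature]

theorem IsPDKernel.integrable_apply (hc : Continuous fun p : X × X => k p.1 p.2) {C : ℝ}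
    (hC : ∀ x y, |k x y| ≤ C) (μ : Measure X) [IsFiniteMeasure μ] (f : hk.Space) :
    Integrable f μ := by
  have h := (hk.integrable_feature hc hC μ).const_inner (𝕜 := ℝ) f
  simpa only [hk.inner_feature] using h

/-- Measures that have the same mean embedding give the same integral to every function in the
reproducing kernel Hilbert space. -/
theorem IsPDKernel.integral_apply_eq_of_meanEmbedding_eq
    (hc : Continuous fun p : X × X => k p.1 p.2) {C : ℝ} (hC : ∀ x y, |k x y| ≤ C)
    {P Q : ProbabilityMeasure X} (h : hk.meanEmbedding P = hk.meanEmbedding Q) (f : hk.Space) :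
    ∫ x, f x ∂(P : Measure X) = ∫ x, f x ∂(Q : Measure X) := by
  rw [← hk.inner_integral_feature hc hC, ← hk.inner_integral_feature hc hC]
  exact congrArg (inner ℝ f) h

theorem IsPDKernel.meanEmbedding_eq_of_integral_eq
    (hc : Continuous fun p : X × X => k p.1 p.2) {C : ℝ} (hC : ∀ x y, |k x y| ≤ C)
    {P Q : ProbabilityMeasure X}
    (h : ∀ x, ∫ y, k y x ∂(P : Measure X) = ∫ y, k y x ∂(Q : Measure X)) :
    hk.meanEmbedding P = hk.meanEmbedding Q := by
  have e : ∀ (R : ProbabilityMeasure X) (x : X),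
      hk.meanEmbedding R x = ∫ y, k y x ∂(R : Measure X) := fun R x => by
    rw [← hk.inner_feature, real_inner_comm, IsPDKernel.meanEmbedding,
      hk.inner_integral_feature hc hC]
    simp only [hk.feature_apply]
  refine RKHS.ext (𝕜 := ℝ) (X := X) (V := ℝ) fun x => ?_
  rw [e, e, h]

/-- Elements of the Hilbert space have the same integral under P and Q, and they approximate test
functions uniformly, at a cost of ε / 2 for each measure. -/
theorem IsPDKernel.meanEmbedding_injective_of_dense [T2Space X] [LocallyCompactSpace X]
    (hc : Continuous fun p : X × X => k p.1 p.2) {C : ℝ} (hC : ∀ x y, |k x y| ≤ C)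
    (hreg : ∀ μ : Measure X, IsFiniteMeasure μ → μ.Regular)
    (hd : ∀ (g : C_c(X, ℝ)) (ε : ℝ), 0 < ε → ∃ f : hk.Space, ∀ x, |f x - g x| ≤ ε) :
    Function.Injective hk.meanEmbedding := by
  intro P Q h
  have rP : (P : Measure X).Regular := hreg _ inferInstance
  have rQ : (Q : Measure X).Regular := hreg _ inferInstance
  suffices hPQ : (P : Measure X) = Q from Subtype.ext hPQ
  refine Measure.ext_of_integral_eq_on_compactlySupported fun g => ?_
  refine eq_of_forall_dist_le fun ε hε => ?_
  obtain ⟨f, hf⟩ := hd g (ε / 2) (by positivity)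
  have key : ∀ R : ProbabilityMeasure X,
      |∫ x, f x ∂(R : Measure X) - ∫ x, g x ∂(R : Measure X)| ≤ ε / 2 := fun R => by
    have hg : Integrable g (R : Measure X) :=
      g.continuous.integrable_of_hasCompactSupport g.hasCompactSupport
    rw [← integral_sub (hk.integrable_apply hc hC _ f) hg]
    simpa using norm_integral_le_of_norm_le_const (μ := (R : Measure X))
      (f := fun x => f x - g x) (.of_forall hf)
  have hP := abs_le.1 (key P)
  have hQ := abs_le.1 (key Q)
  have hPQ := hk.integral_apply_eq_of_meanEmbedding_eq hc hC h f
  change |∫ x, g x ∂(P : Measure X) - ∫ x, g x ∂(Q : Measure X)| ≤ ε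
  rw [abs_le]
  constructor <;> linarith [hP.1, hP.2, hQ.1, hQ.2]

/-- A characteristic kernel separates finite measures of equal mass. -/
theorem IsPDKernel.measure_eq_of_integral_eq (hc : Continuous fun p : X × X => k p.1 p.2) {C : ℝ}
    (hC : ∀ x y, |k x y| ≤ C) (hinj : Function.Injective hk.meanEmbedding)
    {μ₁ μ₂ : Measure X} [IsFiniteMeasure μ₁] [IsFiniteMeasure μ₂]
    (hm : μ₁ Set.univ = μ₂ Set.univ) (h : ∀ x, ∫ y, k y x ∂μ₁ = ∫ y, k y x ∂μ₂) : μ₁ = μ₂ := by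
  -- Zero mass cannot be normalised; otherwise both measures are divided by their common mass.
  rcases eq_or_ne (μ₁ Set.univ) 0 with h0 | h0
  · rw [Measure.measure_univ_eq_zero.1 h0, Measure.measure_univ_eq_zero.1 (hm.symm.trans h0)]
  have : NeZero μ₁ := ⟨fun h => h0 (by simp [h])⟩
  have : NeZero μ₂ := ⟨fun h => h0 (by simp [hm, h])⟩
  have hne : (μ₁ Set.univ)⁻¹ ≠ 0 := by simp
  have hnt : (μ₁ Set.univ)⁻¹ ≠ ⊤ := by simpa using h0
  have i1 : IsProbabilityMeasure ((μ₁ Set.univ)⁻¹ • μ₁) := isProbabilityMeasureSMul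
  have i2 : IsProbabilityMeasure ((μ₁ Set.univ)⁻¹ • μ₂) := hm ▸ isProbabilityMeasureSMul
  have e := @hinj ⟨(μ₁ Set.univ)⁻¹ • μ₁, i1⟩ ⟨(μ₁ Set.univ)⁻¹ • μ₂, i2⟩
    (hk.meanEmbedding_eq_of_integral_eq hc hC fun x => by
      simp only [ProbabilityMeasure.coe_mk, integral_smul_measure, h])
  have e' : (μ₁ Set.univ)⁻¹ • μ₁ = (μ₁ Set.univ)⁻¹ • μ₂ := congrArg Subtype.val e
  have e2 := congrArg (fun μ => μ₁ Set.univ • μ) e'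
  simpa only [smul_smul, ENNReal.mul_inv_cancel h0 (measure_ne_top _ _), one_smul] using e2

end MeanEmbedding

/-- If the sections of `k` restrict to functions on `Z` that vanish at infinity and separate the
finite regular measures on `Z`, then the restrictions to `Z` of the functions in the reproducing
kernel Hilbert space of `k` approximate `C₀(Z, ℝ)` uniformly. -/
theorem IsPDKernel.exists_approx_of_separates_measures {X Z : Type*} {k : X → X → ℝ}
    (hk : IsPDKernel k) [TopologicalSpace Z] [T2Space Z] [LocallyCompactSpace Z]
    [MeasurableSpace Z] [BorelSpace Z] (φ : Z → X)
    (h0 : ∀ x, ∃ h : C₀(Z, ℝ), ∀ z, h z = k (φ z) x)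
    (hs : ∀ μ₁ μ₂ : Measure Z, IsFiniteMeasure μ₁ → IsFiniteMeasure μ₂ → μ₁.Regular →
      μ₂.Regular → (∀ x, ∫ z, k (φ z) x ∂μ₁ = ∫ z, k (φ z) x ∂μ₂) → μ₁ = μ₂)
    (g : C₀(Z, ℝ)) {ε : ℝ} (hε : 0 < ε) : ∃ f : hk.Space, ∀ z, |f (φ z) - g z| ≤ ε := by
  -- Not every element of the Hilbert space is assumed to restrict to `C₀(Z)`; those that do include
  -- the kernel sections, which suffice to separate measures.
  let S : Submodule ℝ C₀(Z, ℝ) :=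
    { carrier := {h | ∃ f : hk.Space, ∀ z, h z = f (φ z)}
      add_mem' := by
        rintro a b ⟨f, hf⟩ ⟨f', hf'⟩
        exact ⟨f + f', fun z => by simp [hf, hf']⟩
      zero_mem' := ⟨0, fun z => by simp⟩
      smul_mem' := by
        rintro c a ⟨f, hf⟩
        exact ⟨c • f, fun z => by simp [hf]⟩ }
  have hg : g ∈ S.topologicalClosure := by
    refine mem_topologicalClosure_of_separates_measures S
      (fun μ₁ μ₂ i1 i2 r1 r2 h => hs μ₁ μ₂ i1 i2 r1 r2 fun x => ?_) g
    obtain ⟨u, hu⟩ := h0 x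
    have := h u ⟨hk.feature x, fun z => by rw [hu, hk.feature_apply]⟩
    simpa only [hu] using this
  obtain ⟨u, ⟨f, hf⟩, hu⟩ := Metric.mem_closure_iff.1 hg ε hε
  refine ⟨f, fun z => ?_⟩
  rw [← hf, abs_sub_comm]
  refine ((g - u).abs_apply_le z).trans ?_
  rw [← dist_eq_norm]
  exact hu.le

/-! ### Characteristic functions and Schoenberg kernels -/

section CharFun

open Complex ProbabilityTheory

theorem integrable_uncurry_exp {X Y : Type*} [TopologicalSpace X] [SecondCountableTopology X]
    [MeasurableSpace X] [BorelSpace X] [TopologicalSpace Y] [SecondCountableTopology Y]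
    [MeasurableSpace Y] [BorelSpace Y] {G : X → Y → ℝ}
    (hG : Continuous fun p : X × Y => G p.1 p.2) (μ : Measure X) (ρ : Measure Y)
    [IsFiniteMeasure μ] [IsFiniteMeasure ρ] :
    Integrable (Function.uncurry fun x y => cexp (G x y * I)) (μ.prod ρ) := by
  refine Integrable.of_bound (C := 1) (Continuous.aestronglyMeasurable ?_)
    (.of_forall fun x => by simp [Function.uncurry, norm_exp_ofReal_mul_I])
  simp only [Function.uncurry_def]
  fun_prop

variable {E : Type*} [NormedAddCommGroup E] [InnerProductSpace ℝ E] [MeasurableSpace E]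
  [BorelSpace E]

variable [SecondCountableTopology E]

/-- Fubini turns the potential of μ into a Fourier integral of its characteristic function against
ρ. -/
theorem integral_charFun_sub (ρ μ : Measure E) [IsFiniteMeasure μ] [IsFiniteMeasure ρ] (x : E) :
    ∫ y, charFun ρ (y - x) ∂μ = ∫ ω, cexp (-(inner ℝ ω x * I)) * charFun μ ω ∂ρ := by
  simp only [charFun_apply]
  rw [integral_integral_swap (integrable_uncurry_exp (G := fun y ω => inner ℝ ω (y - x))
    (by fun_prop) μ ρ)]
  refine integral_congr_ae (.of_forall fun ω => ?_)
  change ∫ y, cexp (inner ℝ ω (y - x) * I) ∂μ =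
    cexp (-(inner ℝ ω x * I)) * ∫ y, cexp (inner ℝ y ω * I) ∂μ
  rw [← integral_const_mul]
  refine integral_congr_ae (.of_forall fun y => ?_)
  change cexp (inner ℝ ω (y - x) * I) = cexp (-(inner ℝ ω x * I)) * cexp (inner ℝ y ω * I)
  rw [← Complex.exp_add, inner_sub_right, real_inner_comm y ω]
  push_cast
  ring_nf

theorem integral_conj_charFun_mul (ρ μ : Measure E) [IsFiniteMeasure μ] [IsFiniteMeasure ρ]
    {D : E → ℂ} (hD : Continuous D) {C : ℝ} (hC : ∀ ω, ‖D ω‖ ≤ C) :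
    ∫ ω, (starRingEnd ℂ) (charFun μ ω) * D ω ∂ρ =
      ∫ x, ∫ ω, cexp (-(inner ℝ ω x * I)) * D ω ∂ρ ∂μ := by
  rw [integral_integral_swap]
  · refine integral_congr_ae (.of_forall fun ω => ?_)
    change (starRingEnd ℂ) (charFun μ ω) * D ω = ∫ x, cexp (-(inner ℝ ω x * I)) * D ω ∂μ
    rw [integral_mul_const, ← charFun_neg, charFun_apply]
    simp [real_inner_comm]
  · refine Integrable.of_bound (C := C) (Continuous.aestronglyMeasurable ?_)
      (.of_forall fun x => ?_)
    · simp only [Function.uncurry_def]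
      fun_prop
    · simpa [Function.uncurry_def, Complex.norm_exp] using hC x.2

/-- If two finite measures have the same potential for the kernel `charFun ρ (x - y)`, then their
characteristic functions agree `ρ`-almost everywhere. -/
theorem charFun_ae_eq_of_integral_charFun_sub_eq (ρ μ₁ μ₂ : Measure E) [IsFiniteMeasure ρ]
    [IsFiniteMeasure μ₁] [IsFiniteMeasure μ₂]
    (h : ∀ x, ∫ y, charFun ρ (y - x) ∂μ₁ = ∫ y, charFun ρ (y - x) ∂μ₂) :
    ∀ᵐ ω ∂ρ, charFun μ₁ ω = charFun μ₂ ω := by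
  set D : E → ℂ := fun ω => charFun μ₁ ω - charFun μ₂ ω with hD
  have hDc : Continuous D := continuous_charFun.sub continuous_charFun
  have hDb : ∀ ω, ‖D ω‖ ≤ μ₁.real Set.univ + μ₂.real Set.univ := fun ω =>
    (norm_sub_le _ _).trans (add_le_add (norm_charFun_le _) (norm_charFun_le _))
  have hint : ∀ {F : E → ℂ} {C : ℝ}, Continuous F → (∀ ω, ‖F ω‖ ≤ C) → Integrable F ρ :=
    fun hF hC => Integrable.of_bound hF.aestronglyMeasurable _ (.of_forall hC)
  have e0 : ∀ x, ∫ ω, cexp (-(inner ℝ ω x * I)) * D ω ∂ρ = 0 := fun x => by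
    simp only [hD, mul_sub]
    rw [integral_sub, ← integral_charFun_sub, ← integral_charFun_sub, h, sub_self]
    · exact hint (C := μ₁.real Set.univ) (by fun_prop) fun ω => by
        simpa [Complex.norm_exp] using norm_charFun_le ω
    · exact hint (C := μ₂.real Set.univ) (by fun_prop) fun ω => by
        simpa [Complex.norm_exp] using norm_charFun_le ω
  have e1 : ∀ μ : Measure E, IsFiniteMeasure μ →
      ∫ ω, (starRingEnd ℂ) (charFun μ ω) * D ω ∂ρ = 0 := fun μ _ => by
    rw [integral_conj_charFun_mul ρ μ hDc hDb]
    simp [e0]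
  -- The energy identity: ∫‖D‖² dρ splits into the pairings of D with the two characteristic
  -- functions, both zero by `e1`.
  have e2 : ∫ ω, ((‖D ω‖ ^ 2 : ℝ) : ℂ) ∂ρ = 0 := by
    have : ∀ ω, ((‖D ω‖ ^ 2 : ℝ) : ℂ) = (starRingEnd ℂ) (charFun μ₁ ω) * D ω -
        (starRingEnd ℂ) (charFun μ₂ ω) * D ω := fun ω => by
      rw [← sub_mul, ← map_sub, Complex.conj_mul']
      push_cast
      rfl
    simp only [this]
    have hb : ∀ μ : Measure E, IsFiniteMeasure μ →
        Integrable (fun ω => (starRingEnd ℂ) (charFun μ ω) * D ω) ρ := fun μ _ => by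
      refine hint (C := μ.real Set.univ * (μ₁.real Set.univ + μ₂.real Set.univ))
        ((Complex.continuous_conj.comp continuous_charFun).mul hDc) fun ω => ?_
      rw [norm_mul, RCLike.norm_conj]
      exact mul_le_mul (norm_charFun_le _) (hDb ω) (norm_nonneg _) (by positivity)
    rw [integral_sub (hb μ₁ inferInstance) (hb μ₂ inferInstance), e1 μ₁ inferInstance,
      e1 μ₂ inferInstance, sub_self]
  rw [integral_complex_ofReal, Complex.ofReal_eq_zero, integral_eq_zero_iff_of_nonneg] at e2
  · filter_upwards [e2] with ω hω
    have : D ω = 0 := by simpa using hω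
    exact sub_eq_zero.1 this
  · exact fun ω => sq_nonneg _
  · refine Integrable.of_bound (C := (μ₁.real Set.univ + μ₂.real Set.univ) ^ 2)
      (Continuous.aestronglyMeasurable (by fun_prop)) (.of_forall fun ω => ?_)
    simpa using pow_le_pow_left₀ (norm_nonneg _) (hDb ω) 2

theorem measurable_sqrt_smul : Measurable fun p : ℝ≥0 × E => √(2 * p.1) • p.2 :=
  Continuous.measurable (by fun_prop)

variable [FiniteDimensional ℝ E]

instance : (stdGaussian E).IsOpenPosMeasure := by
  have : (gaussianReal 0 1).IsOpenPosMeasure :=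
    (gaussianReal_absolutelyContinuous' 0 one_ne_zero).isOpenPosMeasure
  refine Continuous.isOpenPosMeasure_map (by fun_prop) fun x => ?_
  exact ⟨fun i => (stdOrthonormalBasis ℝ E).repr x i, (stdOrthonormalBasis ℝ E).sum_repr x⟩

variable (E) in
/-- The scale mixture of centred Gaussian measures whose characteristic function is
`x ↦ ∫ exp (-t * ‖x‖ ^ 2) dν(t)`. -/
noncomputable def gaussianMixture (ν : Measure ℝ≥0) : Measure E :=
  (ν.prod (stdGaussian E)).map fun p => √(2 * p.1) • p.2

instance (ν : Measure ℝ≥0) [IsFiniteMeasure ν] : IsFiniteMeasure (gaussianMixture E ν) :=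
  Measure.isFiniteMeasure_map _ _

/-- The scale √(2t) turns the standard Gaussian characteristic function exp(-‖x‖²/2) into
exp(-t‖x‖²). -/
theorem charFun_gaussianMixture (ν : Measure ℝ≥0) [IsFiniteMeasure ν] (x : E) :
    charFun (gaussianMixture E ν) x = (∫ t : ℝ≥0, Real.exp (-(t : ℝ) * ‖x‖ ^ 2) ∂ν : ℝ) := by
  rw [charFun_apply, gaussianMixture, integral_map measurable_sqrt_smul.aemeasurable
    (Continuous.aestronglyMeasurable (by fun_prop)), integral_prod, ← integral_complex_ofReal]
  · refine integral_congr_ae (.of_forall fun t => ?_)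
    have h := charFun_stdGaussian (√(2 * t) • x)
    rw [charFun_apply] at h
    simp only [inner_smul_right, inner_smul_left] at h ⊢
    rw [norm_smul] at h
    simp only [RCLike.conj_to_real]
    rw [h, Real.norm_of_nonneg (Real.sqrt_nonneg _), Complex.ofReal_mul, Complex.ofReal_exp,
      mul_pow, ← Complex.ofReal_pow, Real.sq_sqrt (by positivity)]
    push_cast
    ring_nf
  · refine Integrable.of_bound (C := 1) (Continuous.aestronglyMeasurable (by fun_prop))
      (.of_forall fun p => by simp [norm_exp_ofReal_mul_I])

/-- A Schoenberg kernel whose mixing measure charges `(0, ∞)` separates finite measures. -/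
theorem measure_eq_of_integral_gaussianMixture_eq (ν : Measure ℝ≥0) [IsFiniteMeasure ν]
    (hν : ν (Set.Ioi 0) ≠ 0) (μ₁ μ₂ : Measure E) [IsFiniteMeasure μ₁] [IsFiniteMeasure μ₂]
    (h : ∀ x, ∫ y, charFun (gaussianMixture E ν) (y - x) ∂μ₁ =
      ∫ y, charFun (gaussianMixture E ν) (y - x) ∂μ₂) : μ₁ = μ₂ := by
  have h1 := charFun_ae_eq_of_integral_charFun_sub_eq _ μ₁ μ₂ h
  have h2 := Measure.ae_ae_of_ae_prod (ae_of_ae_map measurable_sqrt_smul.aemeasurable h1)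
  -- Disintegrating the mixture yields a single t > 0 at which equality holds Gaussian-a.e.; full
  -- support and continuity then make it hold everywhere.
  obtain ⟨t, ht, ht0⟩ := (h2.and_frequently (frequently_ae_mem_iff.2 hν)).exists
  have h3 := (Continuous.ae_eq_iff_eq (stdGaussian E)
    (f := fun ω => charFun μ₁ (√(2 * t) • ω)) (g := fun ω => charFun μ₂ (√(2 * t) • ω))
    (by fun_prop) (by fun_prop)).1 ht
  refine Measure.ext_of_charFun (funext fun ω => ?_)
  have hs : √(2 * (t : ℝ)) ≠ 0 := by
    have : (0 : ℝ) < t := ht0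
    positivity
  have h4 := congrFun h3 ((√(2 * (t : ℝ)))⁻¹ • ω)
  simpa only [smul_smul, mul_inv_cancel₀ hs, one_smul] using h4

end CharFun

/-! ### Translation-invariant kernels vanishing at infinity -/

section Translation

theorem continuous_zeroAtInfty_sub {E : Type*} [NormedAddCommGroup E] (ψ : C₀(E, ℝ)) :
    Continuous fun p : E × E => ψ (p.1 - p.2) :=
  ψ.continuous.comp (continuous_fst.sub continuous_snd)

theorem measure_eq_of_add_map_add_eq {E : Type*} [NormedAddCommGroup E] [InnerProductSpace ℝ E]
    [Nontrivial E] [CompleteSpace E] [SecondCountableTopology E] [MeasurableSpace E] [BorelSpace E]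
    {μ₁ μ₂ : Measure E} [IsFiniteMeasure μ₁] [IsFiniteMeasure μ₂]
    (h : ∀ a : E, μ₁ + μ₂.map (· + a) = μ₂ + μ₁.map (· + a)) : μ₁ = μ₂ := by
  refine Measure.ext_of_charFun ?_
  refine Continuous.ext_on (dense_compl_singleton (0 : E)) continuous_charFun continuous_charFun
    fun t ht => ?_
  have hadd : ∀ μ ν : Measure E, IsFiniteMeasure μ → IsFiniteMeasure ν →
      charFun (μ + ν) t = charFun μ t + charFun ν t := fun μ ν _ _ => by
    simp only [charFun_apply]
    have hi : ∀ ρ : Measure E, IsFiniteMeasure ρ →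
        Integrable (fun x => Complex.exp (inner ℝ x t * Complex.I)) ρ := fun ρ _ =>
      Integrable.of_bound (C := 1) (Continuous.aestronglyMeasurable (by fun_prop))
        (.of_forall fun x => by simp [Complex.norm_exp_ofReal_mul_I])
    exact integral_add_measure (hi μ inferInstance) (hi ν inferInstance)
  have ht' : ‖t‖ ≠ 0 := norm_ne_zero_iff.2 ht
  -- This translation has phase exp(iπ) = -1 at t, so the identity reads φ₁ - φ₂ = φ₂ - φ₁.
  have e := congrArg (charFun · t) (h ((Real.pi / ‖t‖ ^ 2) • t))
  simp only at e
  rw [hadd _ _ inferInstance inferInstance, hadd _ _ inferInstance inferInstance,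
    charFun_map_add_const, charFun_map_add_const, real_inner_smul_left,
    real_inner_self_eq_norm_sq, div_mul_cancel₀ _ (pow_ne_zero 2 ht'), Complex.exp_pi_mul_I] at e
  linear_combination e / 2

variable {E : Type*} [NormedAddCommGroup E] [InnerProductSpace ℝ E] [FiniteDimensional ℝ E]
  [MeasurableSpace E] [BorelSpace E]

theorem IsC0Universal.isCharacteristic_sub {ψ : C₀(E, ℝ)}
    (h : IsC0Universal fun x y => ψ (x - y)) : IsCharacteristic fun x y => ψ (x - y) := by
  obtain ⟨⟨C, hC⟩, -, hk, hd⟩ := h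
  have hc := continuous_zeroAtInfty_sub ψ
  refine ⟨hc.measurable, ⟨C, hC⟩, hk, ?_⟩
  refine hk.meanEmbedding_injective_of_dense hc hC (fun μ _ => inferInstance) fun g ε hε => ?_
  exact hd ⟨g.toContinuousMap, g.hasCompactSupport.is_zero_at_infty⟩ ε hε

theorem IsCharacteristic.isC0Universal_sub [Nontrivial E] {ψ : C₀(E, ℝ)}
    (h : IsCharacteristic fun x y => ψ (x - y)) : IsC0Universal fun x y => ψ (x - y) := by
  obtain ⟨-, ⟨C, hC⟩, hk, hinj⟩ := h
  have hc := continuous_zeroAtInfty_sub ψ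
  have h0 : ∀ x, ∃ h : C₀(E, ℝ), ∀ y, h y = ψ (y - x) := fun x =>
    ⟨⟨⟨fun y => ψ (y - x), by fun_prop⟩, ψ.zero_at_infty'.comp
      (Homeomorph.subRight x).isClosedEmbedding.tendsto_cocompact⟩, fun y => rfl⟩
  have hint : ∀ (μ : Measure E), IsFiniteMeasure μ → ∀ x, Integrable (fun y => ψ (y - x)) μ :=
    fun μ _ x => by
      obtain ⟨u, hu⟩ := h0 x
      have hi := u.integrable μ
      rwa [funext hu] at hi
  refine ⟨⟨C, hC⟩, h0, hk, fun g ε hε => ?_⟩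
  refine hk.exists_approx_of_separates_measures id h0 (fun μ₁ μ₂ _ _ _ _ hμ => ?_) g hε
  -- Adding the translate of the other measure equalises the masses, and translation invariance of
  -- the kernel keeps the potentials equal.
  refine measure_eq_of_add_map_add_eq fun a => ?_
  refine hk.measure_eq_of_integral_eq hc hC hinj ?_ fun x => ?_
  · have hm : Measurable fun y : E => y + a := measurable_add_const a
    simp only [Measure.add_apply, Measure.map_apply hm MeasurableSet.univ, Set.preimage_univ]
    rw [add_comm]
  · have hm : ∀ μ : Measure E, ∫ y, ψ (y - x) ∂(μ.map (· + a)) = ∫ y, ψ (y - (x - a)) ∂μ := by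
      intro μ
      rw [integral_map (measurable_add_const a).aemeasurable
        (Continuous.aestronglyMeasurable (by fun_prop))]
      congr! 3
      abel
    rw [integral_add_measure (hint _ inferInstance x) (hint _ inferInstance x),
      integral_add_measure (hint _ inferInstance x) (hint _ inferInstance x), hm, hm]
    have e1 := hμ x
    have e2 := hμ (x - a)
    simp only [id] at e1 e2
    rw [e1, e2]

end Translation

/-! ### Translation-invariant kernels on compact groups -/

section CompactGroup

variable {G : Type*} [AddCommGroup G] [TopologicalSpace G] [IsTopologicalAddGroup G]
  [CompactSpace G] [T2Space G] [SecondCountableTopology G] [MeasurableSpace G] [BorelSpace G]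

/-- Fubini, with invariance of Haar measure under x ↦ y - x. -/
theorem measureReal_univ_mul_integral (m : Measure G) [m.IsAddHaarMeasure] (ψ : C(G, ℝ))
    (μ : Measure G) [IsFiniteMeasure μ] :
    ∫ x, ∫ y, ψ (y - x) ∂μ ∂m = μ.real Set.univ * ∫ x, ψ x ∂m := by
  rw [integral_integral_swap]
  · simp [integral_sub_left_eq_self (fun x => ψ x) m]
  · refine Integrable.of_bound (C := ‖ψ‖) (Continuous.aestronglyMeasurable ?_)
      (.of_forall fun p => ψ.norm_coe_le_norm _)
    simp only [Function.uncurry_def]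
    fun_prop

theorem IsCharacteristic.isCUniversal_sub (m : Measure G) [m.IsAddHaarMeasure] {ψ : C(G, ℝ)}
    (h : IsCharacteristic fun x y => ψ (x - y)) (hψ : ∫ x, ψ x ∂m ≠ 0) :
    IsCUniversal fun x y => ψ (x - y) := by
  obtain ⟨-, ⟨C, hC⟩, hk, hinj⟩ := h
  have hc : Continuous fun p : G × G => ψ (p.1 - p.2) := by fun_prop
  refine ⟨hc, hk, fun g ε hε => ?_⟩
  -- On a compact space every continuous function vanishes at infinity.
  refine hk.exists_approx_of_separates_measures id (fun x =>
    ⟨ZeroAtInftyContinuousMap.ContinuousMap.liftZeroAtInfty ⟨fun y => ψ (y - x), by fun_prop⟩, fun y => rfl⟩)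
    (fun μ₁ μ₂ _ _ _ _ hμ => ?_) (ZeroAtInftyContinuousMap.ContinuousMap.liftZeroAtInfty g) hε
  refine hk.measure_eq_of_integral_eq hc hC hinj ?_ hμ
  have e1 := measureReal_univ_mul_integral m ψ μ₁
  simp only [id] at hμ
  simp only [hμ] at e1
  rw [measureReal_univ_mul_integral m ψ μ₂] at e1
  exact ((measureReal_eq_measureReal_iff).1 (mul_right_cancel₀ hψ e1)).symm

end CompactGroup

theorem re_torusFourierCoeff_zero {d : ℕ} (ψ : C(Torus d, ℝ)) :
    (torusFourierCoeff ψ 0).re = ((2 * Real.pi) ^ d)⁻¹ * ∫ x, ψ x := by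
  have : (∫ x : Torus d, (∏ i, fourier (-((0 : Fin d → ℤ) i)) (x i)) * (ψ x : ℂ)) =
      ((∫ x, ψ x : ℝ) : ℂ) := by
    rw [← integral_complex_ofReal]
    simp
  rw [torusFourierCoeff, this, ← Complex.ofReal_inv, ← Complex.ofReal_mul, Complex.ofReal_re]

/-! ### Radial kernels -/

section Radial

theorem exists_forall_eq_of_measure_Ioi_eq_zero {E : Type*} [NormedAddCommGroup E]
    {ν : Measure ℝ≥0} (hν : ν (Set.Ioi 0) = 0)
    {k : E → E → ℝ} (hk : ∀ x y, k x y = ∫ t : ℝ≥0, Real.exp (-(t : ℝ) * ‖x - y‖ ^ 2) ∂ν) :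
    ∃ c, ∀ x y, k x y = c := by
  refine ⟨∫ _, 1 ∂ν, fun x y => ?_⟩
  rw [hk]
  refine integral_congr_ae ?_
  have h : ∀ᵐ t ∂ν, t ∉ Set.Ioi 0 := measure_eq_zero_iff_ae_notMem.1 hν
  filter_upwards [h] with t ht
  have : t = 0 := by simpa using ht
  simp [this]

theorem not_isCCUniversal_of_forall_eq {E : Type*} [NormedAddCommGroup E]
    [Nontrivial E] {k : E → E → ℝ} {c : ℝ}
    (hc : ∀ x y, k x y = c) : ¬ IsCCUniversal k := by
  rintro ⟨-, hk, hd⟩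
  obtain ⟨x, hx⟩ := exists_ne (0 : E)
  have hx' : 0 < ‖x‖ := norm_pos_iff.2 hx
  -- The target takes the values 0 and ‖x‖ at the two points, while f takes the same value at both,
  -- so an error of ‖x‖ / 3 is impossible.
  obtain ⟨f, hf⟩ := hd {0, x} (Set.toFinite _).isCompact ⟨fun z => ‖(z : E)‖, by fun_prop⟩
    (‖x‖ / 3) (by positivity)
  have hΦ : hk.feature 0 = hk.feature x := RKHS.ext (𝕜 := ℝ) (X := E) (V := ℝ) fun z => by
    rw [hk.feature_apply, hk.feature_apply, hc, hc]
  have hfx : f 0 = f x := by rw [← hk.inner_feature, ← hk.inner_feature, hΦ]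
  have h1 := abs_le.1 (hf ⟨0, by simp⟩)
  have h2 := abs_le.1 (hf ⟨x, by simp⟩)
  simp only [ContinuousMap.coe_mk, norm_zero] at h1 h2
  linarith [h1.2, h2.1]

variable {E : Type*} [NormedAddCommGroup E] [InnerProductSpace ℝ E] [FiniteDimensional ℝ E]
  [MeasurableSpace E] [BorelSpace E]

theorem not_isCharacteristic_of_forall_eq [Nontrivial E] {k : E → E → ℝ} {c : ℝ}
    (hc : ∀ x y, k x y = c) : ¬ IsCharacteristic k := by
  rintro ⟨-, -, hk, hinj⟩
  obtain ⟨x, y, hxy⟩ := exists_pair_ne E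
  have hcont : Continuous fun p : E × E => k p.1 p.2 := by simp only [hc]; fun_prop
  have e := hinj (hk.meanEmbedding_eq_of_integral_eq hcont (C := |c|) (fun x y => by rw [hc])
    (P := ⟨Measure.dirac x, inferInstance⟩) (Q := ⟨Measure.dirac y, inferInstance⟩) fun z => by
      simp [hc])
  exact hxy (dirac_eq_dirac_iff.1 (congrArg Subtype.val e))

theorem eq_charFun_gaussianMixture {ν : Measure ℝ≥0} [IsFiniteMeasure ν] {k : E → E → ℝ}
    (hk : ∀ x y, k x y = ∫ t : ℝ≥0, Real.exp (-(t : ℝ) * ‖x - y‖ ^ 2) ∂ν) (x y : E) :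
    (k x y : ℂ) = charFun (gaussianMixture E ν) (x - y) := by
  rw [hk, charFun_gaussianMixture]

theorem isCCUniversal_iff_isCharacteristic [Nontrivial E] {ν : Measure ℝ≥0} [IsFiniteMeasure ν]
    {k : E → E → ℝ}
    (hkν : ∀ x y, k x y = ∫ t : ℝ≥0, Real.exp (-(t : ℝ) * ‖x - y‖ ^ 2) ∂ν) :
    IsCCUniversal k ↔ IsCharacteristic k := by
  rcases eq_or_ne (ν (Set.Ioi 0)) 0 with h0 | h0
  · obtain ⟨c, hc⟩ := exists_forall_eq_of_measure_Ioi_eq_zero h0 hkν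
    exact iff_of_false (not_isCCUniversal_of_forall_eq hc) (not_isCharacteristic_of_forall_eq hc)
  have hkc := eq_charFun_gaussianMixture hkν
  have hc : Continuous fun p : E × E => k p.1 p.2 := by
    have h : Continuous fun p : E × E => (charFun (gaussianMixture E ν) (p.1 - p.2)).re :=
      Complex.continuous_re.comp (continuous_charFun.comp (by fun_prop))
    simpa only [← hkc, Complex.ofReal_re] using h
  have hC : ∀ x y, |k x y| ≤ (gaussianMixture E ν).real Set.univ := fun x y => by
    rw [← Real.norm_eq_abs, ← Complex.norm_real, hkc]
    exact norm_charFun_le _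
  have hsep : ∀ μ₁ μ₂ : Measure E, IsFiniteMeasure μ₁ → IsFiniteMeasure μ₂ →
      (∀ x, ∫ y, k y x ∂μ₁ = ∫ y, k y x ∂μ₂) → μ₁ = μ₂ := fun μ₁ μ₂ _ _ h => by
    refine measure_eq_of_integral_gaussianMixture_eq ν h0 μ₁ μ₂ fun x => ?_
    simp only [← hkc, integral_complex_ofReal, h]
  constructor
  · rintro ⟨-, hk, -⟩
    refine ⟨hc.measurable, ⟨_, hC⟩, hk, fun P Q hPQ => ?_⟩
    refine Subtype.ext (hsep P Q inferInstance inferInstance fun x => ?_)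
    have e := hk.integral_apply_eq_of_meanEmbedding_eq hc hC hPQ (hk.feature x)
    simpa only [hk.feature_apply] using e
  · rintro ⟨-, -, hk, -⟩
    refine ⟨hc, hk, fun Z hZ g ε hε => ?_⟩
    have : CompactSpace Z := isCompact_iff_compactSpace.1 hZ
    have hsec : ∀ x, Continuous fun y => k y x := fun x =>
      hc.comp (continuous_id.prodMk continuous_const)
    refine hk.exists_approx_of_separates_measures (Subtype.val : Z → E) (fun x =>
      ⟨ZeroAtInftyContinuousMap.ContinuousMap.liftZeroAtInfty ⟨fun z => k z x, (hsec x).comp continuous_subtype_val⟩,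
        fun y => rfl⟩)
      (fun μ₁ μ₂ _ _ _ _ hμ => ?_) (ZeroAtInftyContinuousMap.ContinuousMap.liftZeroAtInfty g) hε
    have hemb : MeasurableEmbedding (Subtype.val : Z → E) :=
      MeasurableEmbedding.subtype_coe hZ.measurableSet
    -- Separation holds on all of E, so measures on Z are compared through their push-forwards and
    -- then pulled back.
    have e : μ₁.map Subtype.val = μ₂.map Subtype.val :=
      hsep _ _ inferInstance inferInstance fun x => by
        rw [hemb.integral_map, hemb.integral_map, hμ]
    rw [← hemb.comap_map μ₁, e, hemb.comap_map]

end Radial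

theorem mainTheorem3 (d : ℕ) (hd : 1 ≤ d) :
    (∀ ψ : C₀(EuclideanSpace ℝ (Fin d), ℝ), ψ ≠ 0 →
      IsPDKernel (fun x y => ψ (x - y)) →
      (IsC0Universal (fun x y => ψ (x - y)) ↔ IsCharacteristic (fun x y => ψ (x - y)))) ∧
    (∀ ψ : C(Torus d, ℝ),
      IsPDKernel (fun x y => ψ (x - y)) →
      IsCharacteristic (fun x y => ψ (x - y)) →
      0 < (torusFourierCoeff ψ 0).re →
      IsCUniversal (fun x y => ψ (x - y))) ∧
    (∀ k : EuclideanSpace ℝ (Fin d) → EuclideanSpace ℝ (Fin d) → ℝ,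
      IsSchoenbergKernel k →
      (IsCCUniversal k ↔ IsCharacteristic k)) := by
  -- This makes the Euclidean space nontrivial, as needed for (a) and (c).
  have : Nonempty (Fin d) := ⟨⟨0, hd⟩⟩
  refine ⟨fun ψ _ _ => ⟨fun h => h.isCharacteristic_sub, fun h => h.isC0Universal_sub⟩,
    fun ψ _ h hψ => h.isCUniversal_sub volume fun h0 => ?_, ?_⟩
  · rw [re_torusFourierCoeff_zero, h0, mul_zero] at hψ
    exact lt_irrefl _ hψ
  · rintro k ⟨ν, _, hkν⟩
    exact isCCUniversal_iff_isCharacteristic hkν
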